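/- For integers $n\ge 7$, let $\langle\{1,2,3\}\rangle_n$ be the circulant graph with vertex set $\mathbb{Z}_n$ in which two distinct vertices $x,y$ are adjacent if and only if $x-y\in\{\pm1,\pm2,\pm3\}$ (modulo $n$). For a list $M=(m_1,\ldots,m_s)$ of integers with every $m_i\ge 3$, an $(M)$-decomposition of a graph $K$ all of whose vertices have even degree is a set $\{G_1,\ldots,G_s\}$ of subgraphs of $K$ whose edge sets partition the edge set of $K$ and such that $G_i$ is a cycle with $m_i$ edges for $i=1,\ldots,s$. If $n\ge 7$ and $M=(m_1,\ldots,m_t,k,n)$ is any list of integers satisfying $m_i\in\{3,4,5\}$ for $i=1,\ldots,t$, $3\le k\le n$, and $m_1+\cdots+m_t+k+n=3n$, then there is an $(M)$-decomposition of $\langle\{1,2,3\}\rangle_n$. -/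

import Mathlib

/-- The subgraph `H` of `K` is an `m`-cycle: it consists of the vertices and edges of a closed walk
of length `m` in `K` that repeats no vertex (apart from its two ends) and no edge. -/
def IsCycleOfLength {V : Type*} {K : SimpleGraph V} (m : ℕ) (H : K.Subgraph) : Prop :=
  ∃ (v : V) (c : K.Walk v v), c.IsCycle ∧ c.length = m ∧ c.toSubgraph = H

/-- The family `G` of subgraphs of `K` is a decomposition of `K`: the edge sets of its members
partition the edge set of `K`. -/
def IsGraphDecomposition {V ι : Type*} (K : SimpleGraph V) (G : ι → K.Subgraph) : Prop :=
  (Pairwise fun i j => Disjoint (G i).edgeSet (G j).edgeSet) ∧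
    (⋃ i, (G i).edgeSet) = K.edgeSet

/-- For a list `M = (m₁, …, mₜ)`, the graph `K` (all of whose degrees are then even) has an
`(M)`-decomposition: a decomposition `{G₁, …, Gₜ}` such that `Gᵢ` is an `mᵢ`-cycle for each `i`. -/
def HasCycleDecomposition {V : Type*} (K : SimpleGraph V) (M : List ℕ) : Prop :=
  ∃ G : Fin M.length → K.Subgraph,
    IsGraphDecomposition K G ∧ ∀ i, IsCycleOfLength (M.get i) (G i)

/-!
Number the vertices `0, 1, 2, …` and cut the circulant graph open into a strip: `strip n` consists of
the edges `{i, i + d}` with `i < n` and `d ∈ {1, 2, 3}`, and becomes the circulant graph when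
vertices are reduced modulo `n` (`nodup_map_strip`, `mem_map_strip_iff`). The decomposition is built
on strips of growing width by attaching blocks on the right, each of them a small decomposition that
is checked by evaluation.

The Hamiltonian cycle is kept as two paths, one joining `0` to `2` at the left end and one turning
around near the right end; both ends of the latter are prolonged by each block. When the strip is
closed up, the ends of the two paths are identified, and whichever way the strands of the blocks are
paired, a single cycle results. The `k`-cycle is treated likewise: it grows from left to right as a
path with both its ends at the right (`OpenState`), until a block joins these ends (`ClosedState`).

While the `k`-cycle is open, blocks with a `4`-cycle, a `5`-cycle or two `3`-cycles lengthen it by the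
sum of the lengths of their short cycles (`OpenState.step`). Once it is closed, blocks with cycles of
lengths `(4)`, `(3, 3)`, `(3, 5)` or `(5, 5)` are attached (`ClosedState.step`). Hence the `k`-cycle
is lengthened until a path with at most six vertices can close it, a suitable closing block is
chosen (`OpenState.finish`), and the remaining short cycles, the sum of whose
lengths is even, are placed outside (`ClosedState.fill`).

No closing block suits when all `mᵢ` are `3` and `3 ∣ k`. Then the construction starts from
another block, with one triangle (`OpenState.base_three`, `OpenState.finish_threes`), or, if `k = 3`
too, from four triangles (`ClosedState.base_three`). If `k = 3` but some `mᵢ` is `4` or `5`, such an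
`mᵢ` takes the role of `k`.
-/

/-! ### Walks and cycles recorded by their vertices and edges -/

/-- `WalkOn a b S E`: there is a walk from `a` to `b` (in the complete graph with loops) whose
visited vertices and traversed edges, listed with multiplicity, are `S` and `E`. -/
inductive WalkOn {V : Type*} : V → V → Multiset V → Multiset (Sym2 V) → Prop
  | nil (a : V) : WalkOn a a {a} 0
  | cons (a : V) {b c : V} {S : Multiset V} {E : Multiset (Sym2 V)} :
      WalkOn b c S E → WalkOn a c (a ::ₘ S) (s(a, b) ::ₘ E)

namespace WalkOn

variable {V W : Type*} {a b c : V} {S T : Multiset V} {E F : Multiset (Sym2 V)}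

theorem map (f : V → W) (h : WalkOn a b S E) :
    WalkOn (f a) (f b) (S.map f) (E.map (Sym2.map f)) := by
  induction h with
  | nil a => simpa using WalkOn.nil (f a)
  | cons a _ ih => simpa using WalkOn.cons (f a) ih

theorem append (h : WalkOn a b S E) (h' : WalkOn b c T F) :
    ∃ U, U + {b} = S + T ∧ WalkOn a c U (E + F) := by
  induction h with
  | nil a => exact ⟨T, add_comm _ _, by simpa using h'⟩
  | cons a _ ih =>
    obtain ⟨U, hU, hw⟩ := ih h'
    exact ⟨a ::ₘ U, by simp [hU], by simpa using hw.cons a⟩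

theorem symm (h : WalkOn a b S E) : WalkOn b a S E := by
  induction h with
  | nil a => exact .nil a
  | @cons a b c S E _ ih =>
    obtain ⟨U, hU, hw⟩ := ih.append (.cons b (.nil a))
    obtain rfl : U = a ::ₘ S := by
      refine add_right_cancel (b := {b}) (hU.trans ?_)
      rw [← Multiset.singleton_add a S, ← Multiset.singleton_add b {a}]
      abel
    have hE : E + s(b, a) ::ₘ 0 = s(a, b) ::ₘ E := by
      rw [Sym2.eq_swap, Multiset.add_cons, add_zero]
    rwa [hE] at hw

/-- Prolonging a walk at both ends. -/
theorem extend {a' b' : V} {S₁ S₂ : Multiset V} {E₁ E₂ : Multiset (Sym2 V)}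
    (h : WalkOn a b S E) (h₁ : WalkOn a a' S₁ E₁) (h₂ : WalkOn b b' S₂ E₂) :
    ∃ U, U + {a, b} = S + S₁ + S₂ ∧ WalkOn a' b' U (E + E₁ + E₂) := by
  obtain ⟨U, hU, hw⟩ := h₁.symm.append h
  obtain ⟨X, hX, hw'⟩ := hw.append h₂
  refine ⟨X, ?_, by rwa [add_comm E₁ E] at hw'⟩
  calc X + {a, b} = X + {b} + {a} := by
        rw [Multiset.insert_eq_cons, ← Multiset.singleton_add]; abel
    _ = U + {a} + S₂ := by rw [hX]; abel
    _ = S + S₁ + S₂ := by rw [hU]; abel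

/-- A walk whose edges all belong to a graph is a walk of that graph. -/
theorem exists_walk {K : SimpleGraph V} (h : WalkOn a b S E) (hE : ∀ e ∈ E, e ∈ K.edgeSet) :
    ∃ p : K.Walk a b, (p.support : Multiset V) = S ∧ (p.edges : Multiset (Sym2 V)) = E := by
  induction h with
  | nil a => exact ⟨.nil, by simp, by simp⟩
  | @cons a b c S E _ ih =>
    obtain ⟨p, hS, hE'⟩ := ih fun e he => hE e (Multiset.mem_cons_of_mem he)
    have hab : K.Adj a b := hE s(a, b) (Multiset.mem_cons_self _ _)
    exact ⟨.cons hab p, by simp [← hS, ← Multiset.cons_coe], by simp [← hE', ← Multiset.cons_coe]⟩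

end WalkOn

/-- `ClosedWalkOn S E`: there is a closed walk with vertices `S` and edges `E`, presented as a walk
together with the edge joining its ends; the starting point is counted once in `S`. -/
def ClosedWalkOn {V : Type*} (S : Multiset V) (E : Multiset (Sym2 V)) : Prop :=
  ∃ (a b : V) (F : Multiset (Sym2 V)), WalkOn a b S F ∧ E = s(b, a) ::ₘ F

namespace ClosedWalkOn

variable {V W : Type*} {S : Multiset V} {E : Multiset (Sym2 V)}

theorem map (f : V → W) (h : ClosedWalkOn S E) :
    ClosedWalkOn (S.map f) (E.map (Sym2.map f)) := by
  obtain ⟨a, b, F, h, rfl⟩ := h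
  exact ⟨f a, f b, _, h.map f, by simp⟩

/-- Two walks with the same pair of distinct ends form a closed walk. -/
theorem of_walkOn {a b : V} {S T : Multiset V} {E F : Multiset (Sym2 V)} (hab : a ≠ b)
    (h : WalkOn a b S E) (h' : WalkOn a b T F) :
    ∃ U, U + {a, b} = S + T ∧ ClosedWalkOn U (E + F) := by
  cases h with
  | nil => exact absurd rfl hab
  | @cons _ x _ S E h =>
    obtain ⟨U, hU, hw⟩ := h.append h'.symm
    refine ⟨U, ?_, x, a, E + F, hw, by simp⟩
    rw [Multiset.insert_eq_cons, Multiset.add_cons, hU, Multiset.cons_add]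

/-- A closed walk of a graph without repeated vertices and edges is a cycle. -/
theorem exists_subgraph {K : SimpleGraph V} (h : ClosedWalkOn S E) (hS : S.Nodup) (hE : E.Nodup)
    (hK : ∀ e ∈ E, e ∈ K.edgeSet) :
    ∃ H : K.Subgraph, IsCycleOfLength S.card H ∧ H.edgeSet = {e | e ∈ E} := by
  obtain ⟨a, b, F, h, rfl⟩ := h
  obtain ⟨p, rfl, rfl⟩ := h.exists_walk fun e he => hK e (Multiset.mem_cons_of_mem he)
  have hba : K.Adj b a := hK s(b, a) (Multiset.mem_cons_self _ _)
  refine ⟨(SimpleGraph.Walk.cons hba p).toSubgraph, ⟨b, .cons hba p, ?_, by simp, rfl⟩, ?_⟩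
  · rw [SimpleGraph.Walk.cons_isCycle_iff, SimpleGraph.Walk.isPath_def]
    exact ⟨hS, by simpa using (Multiset.nodup_cons.1 hE).1⟩
  · ext e
    rw [SimpleGraph.Walk.mem_edges_toSubgraph]
    simp

end ClosedWalkOn

/-! ### Edge multisets split into closed walks -/

/-- `CycleSum P M E`: the edge multiset `E` is the sum of the edge multisets of closed walks whose
vertex multisets satisfy `P` and whose lengths form the multiset `M`. -/
inductive CycleSum {V : Type*} (P : Multiset V → Prop) :
    Multiset ℕ → Multiset (Sym2 V) → Prop
  | nil : CycleSum P 0 0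
  | cons {S : Multiset V} {E F : Multiset (Sym2 V)} {M : Multiset ℕ} :
      ClosedWalkOn S E → P S → CycleSum P M F → CycleSum P (S.card ::ₘ M) (E + F)

namespace CycleSum

variable {V W : Type*} {P : Multiset V → Prop} {M N : Multiset ℕ} {E F : Multiset (Sym2 V)}

theorem add (h : CycleSum P M E) (h' : CycleSum P N F) : CycleSum P (M + N) (E + F) := by
  induction h with
  | nil => simpa using h'
  | cons hc hP _ ih => simpa [add_assoc] using CycleSum.cons hc hP ih

theorem map {Q : Multiset W → Prop} (f : V → W) (hf : ∀ S, P S → Q (S.map f))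
    (h : CycleSum P M E) : CycleSum Q M (E.map (Sym2.map f)) := by
  induction h with
  | nil => exact .nil
  | @cons S E F M hc hP _ ih =>
    have := CycleSum.cons (hc.map f) (hf S hP) ih
    rwa [Multiset.card_map, ← Multiset.map_add] at this

theorem eq_zero_of_zero {L : Multiset ℕ} (h : CycleSum P L E) (hL : L = 0) : E = 0 := by
  cases h with
  | nil => rfl
  | cons => exact absurd hL Multiset.cons_ne_zero

/-- Any prescribed length in `L` can be split off first. -/
theorem exists_of_cons {m : ℕ} {L : Multiset ℕ} (h : CycleSum P L E) (hL : L = m ::ₘ M) :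
    ∃ (S : Multiset V) (E₁ E₂ : Multiset (Sym2 V)), S.card = m ∧ ClosedWalkOn S E₁ ∧ P S ∧
      CycleSum P M E₂ ∧ E = E₁ + E₂ := by
  induction h generalizing M with
  | nil => exact absurd hL.symm (Multiset.cons_ne_zero)
  | @cons S E F L hc hP h ih =>
    rcases Multiset.cons_eq_cons.1 hL with ⟨hm, rfl⟩ | ⟨_, N, rfl, rfl⟩
    · exact ⟨S, E, F, hm, hc, hP, h, rfl⟩
    · obtain ⟨S', E₁, E₂, hm, hc', hP', h', rfl⟩ := ih rfl
      exact ⟨S', E₁, E + E₂, hm, hc', hP', .cons hc hP h', add_left_comm _ _ _⟩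

/-- If the edges of a graph split into closed walks without repeated vertices, then the graph
decomposes into cycles of the corresponding lengths. -/
theorem exists_subgraphs {K : SimpleGraph V} (l : List ℕ)
    (h : CycleSum Multiset.Nodup (l : Multiset ℕ) E)
    (hE : E.Nodup) (hK : ∀ e ∈ E, e ∈ K.edgeSet) :
    ∃ G : Fin l.length → K.Subgraph,
      (Pairwise fun i j => Disjoint (G i).edgeSet (G j).edgeSet) ∧
      (⋃ i, (G i).edgeSet) = {e | e ∈ E} ∧ ∀ i, IsCycleOfLength (l.get i) (G i) := by
  induction l generalizing E with
  | nil =>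
    obtain rfl := h.eq_zero_of_zero rfl
    exact ⟨fun i => i.elim0, fun i => i.elim0, by simp, fun i => i.elim0⟩
  | cons m l ih =>
    obtain ⟨S, E₁, E₂, rfl, hc, hS, h', rfl⟩ := h.exists_of_cons (Multiset.cons_coe m l).symm
    obtain ⟨h₁, h₂, hd⟩ := Multiset.nodup_add.1 hE
    obtain ⟨H, hH, hHE⟩ := hc.exists_subgraph hS h₁ fun e he =>
      hK e (Multiset.mem_add.2 (Or.inl he))
    obtain ⟨G, hG, hGE, hGc⟩ := ih h' h₂ fun e he => hK e (Multiset.mem_add.2 (Or.inr he))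
    have hdisj : ∀ i, Disjoint H.edgeSet (G i).edgeSet := by
      intro i
      rw [Set.disjoint_left]
      intro e he he'
      rw [hHE] at he
      have : e ∈ ⋃ i, (G i).edgeSet := Set.mem_iUnion.2 ⟨i, he'⟩
      rw [hGE] at this
      exact Multiset.disjoint_left.1 hd he this
    refine ⟨Fin.cons H G, ?_, ?_, ?_⟩
    · intro i j hij
      induction i using Fin.cases with
      | zero =>
        induction j using Fin.cases with
        | zero => exact absurd rfl hij
        | succ j => exact hdisj j
      | succ i =>
        induction j using Fin.cases with
        | zero => exact (hdisj i).symm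
        | succ j => exact hG fun h => hij (congrArg _ h)
    · ext e
      have : (e ∈ ⋃ i, (G i).edgeSet) ↔ e ∈ E₂ := by rw [hGE]; rfl
      rw [Set.mem_iUnion] at this
      simp [Fin.exists_fin_succ, hHE, this]
    · intro i
      induction i using Fin.cases with
      | zero => exact hH
      | succ i => exact hGc i

end CycleSum

theorem hasCycleDecomposition_of_cycleSum {V : Type*} {K : SimpleGraph V} {l : List ℕ}
    {E : Multiset (Sym2 V)} (h : CycleSum Multiset.Nodup (l : Multiset ℕ) E) (hE : E.Nodup)
    (hK : ∀ e, e ∈ E ↔ e ∈ K.edgeSet) : HasCycleDecomposition K l := by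
  obtain ⟨G, hd, hu, hc⟩ := h.exists_subgraphs l hE fun e he => (hK e).1 he
  exact ⟨G, ⟨hd, hu.trans (Set.ext hK)⟩, hc⟩

/-! ### Walks given by lists -/

/-- The edges joining consecutive members of a list. -/
def pathEdges {V : Type*} : List V → Multiset (Sym2 V)
  | [] => 0
  | [_] => 0
  | a :: b :: l => s(a, b) ::ₘ pathEdges (b :: l)

/-- The edges of the closed walk through the members of a list in their cyclic order. -/
def cycleEdges {V : Type*} : List V → Multiset (Sym2 V)
  | [] => 0
  | a :: l => s((a :: l).getLast (List.cons_ne_nil a l), a) ::ₘ pathEdges (a :: l)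

theorem walkOn_pathEdges {V : Type*} (a : V) (l : List V) :
    WalkOn a ((a :: l).getLast (List.cons_ne_nil a l)) (a :: l : List V) (pathEdges (a :: l)) := by
  induction l generalizing a with
  | nil => exact .nil a
  | cons b l ih => simpa [pathEdges] using (ih b).cons a

theorem walkOn_of_list {V : Type*} {l : List V} {a b : V} (ha : l.head? = some a)
    (hb : l.getLast? = some b) : WalkOn a b (l : Multiset V) (pathEdges l) := by
  cases l with
  | nil => simp at ha
  | cons x l =>
    obtain rfl : x = a := by simpa using ha
    obtain rfl : (x :: l).getLast (List.cons_ne_nil x l) = b := by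
      simpa [List.getLast?_eq_getLast_of_ne_nil] using hb
    exact walkOn_pathEdges x l

theorem closedWalkOn_cycleEdges {V : Type*} {l : List V} (hl : l ≠ []) :
    ClosedWalkOn (l : Multiset V) (cycleEdges l) := by
  cases l with
  | nil => exact absurd rfl hl
  | cons a l => exact ⟨_, _, _, walkOn_pathEdges a l, rfl⟩

/-! ### Strips and their translates -/

/-- The edges `{i, i + 1}`, `{i, i + 2}`, `{i, i + 3}` with `i < w`. Reduced modulo `n`, those of
`strip n` are the edges of the circulant graph with jumps `1`, `2`, `3`. -/
def strip (w : ℕ) : Multiset (Sym2 ℕ) :=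
  (Multiset.range w).bind fun i => {s(i, i + 1), s(i, i + 2), s(i, i + 3)}

theorem strip_add (n w : ℕ) :
    strip (n + w) = strip n + (strip w).map (Sym2.map (n + ·)) := by
  simp only [strip, Multiset.range_add, Multiset.add_bind, Multiset.bind_map, Multiset.map_bind]
  simp [add_assoc]

/-- The requirement on the vertices of a cycle in a strip that lets it survive reduction modulo
any `n ≥ 7`. -/
def IsShort (S : Multiset ℕ) : Prop := S.Nodup ∧ ∃ c, ∀ x ∈ S, c ≤ x ∧ x < c + 7

theorem IsShort.map_add {S : Multiset ℕ} (h : IsShort S) (n : ℕ) : IsShort (S.map (n + ·)) := by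
  obtain ⟨h, c, hc⟩ := h
  refine ⟨h.map (add_right_injective n), n + c, fun x hx => ?_⟩
  obtain ⟨y, hy, rfl⟩ := Multiset.mem_map.1 hx
  have := hc y hy
  constructor <;> lia

/-- The members of `cs` list the vertices of cycles that satisfy `IsShort`, in a form which can be
decided. -/
abbrev AreShort (cs : List (List ℕ)) : Prop :=
  ∀ l ∈ cs, l ≠ [] ∧ l.Nodup ∧ ∀ x ∈ l, ∀ y ∈ l, y < x + 7

theorem cycleSum_of_areShort {cs : List (List ℕ)} (h : AreShort cs) :
    CycleSum IsShort (cs.map List.length : List ℕ) (cs.map cycleEdges).sum := by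
  induction cs with
  | nil => exact .nil
  | cons l cs ih =>
    obtain ⟨hl, hn, hw⟩ := h l (by simp)
    have hs : IsShort (l : Multiset ℕ) := by
      obtain ⟨c, hc⟩ : ∃ c, c ∈ l.toFinset ∧ ∀ x ∈ l.toFinset, c ≤ x :=
        l.toFinset.exists_min_image id (by simpa using hl)
      simp only [List.mem_toFinset] at hc
      exact ⟨hn, c, fun x hx => ⟨hc.2 x hx, hw c hc.1 x hx⟩⟩
    exact .cons (closedWalkOn_cycleEdges hl) hs (ih fun l' hl' => h l' (by simp [hl']))

/-- The lists `r` and `s` are walks starting at `p` and `q` and ending at `p'` and `q'`, in either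
order. -/
abbrev AreStrands (r s : List ℕ) (p q p' q' : ℕ) : Prop :=
  r.head? = some p ∧ s.head? = some q ∧
    (r.getLast? = some p' ∧ s.getLast? = some q' ∨ r.getLast? = some q' ∧ s.getLast? = some p')

/-- The order in which two strands end is irrelevant when they prolong a walk at both ends. -/
theorem WalkOn.strands {n p q p' q' : ℕ} {S : Multiset ℕ} {E : Multiset (Sym2 ℕ)} {r s : List ℕ}
    (h : WalkOn (n + p) (n + q) S E) (hrs : AreStrands r s p q p' q') :
    ∃ U, U + {n + p, n + q} = S + (r + s : Multiset ℕ).map (n + ·) ∧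
      WalkOn (n + p') (n + q') U
        (E + (pathEdges r + pathEdges s).map (Sym2.map (n + ·))) := by
  obtain ⟨hr, hs, ⟨hr', hs'⟩ | ⟨hr', hs'⟩⟩ := hrs <;>
  · obtain ⟨U, hU, hw⟩ := h.extend ((walkOn_of_list hr hr').map (n + ·))
      ((walkOn_of_list hs hs').map (n + ·))
    rw [add_assoc, ← Multiset.map_add] at hU hw
    first
    | exact ⟨U, hU, hw⟩
    | exact ⟨U, hU, hw.symm⟩

/-! ### Decompositions of strips -/

/-- A decomposition of `strip n` that can be continued to the right both inside and outside of the
long cycle. It consists of cycles with lengths `M`; of two paths which are the Hamiltonian cycle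
built so far, one from `0` to `2` and one from `n + 1` to `n + 2`, together visiting each of
`0, …, n + 2` once; and of a path from `n` to `n + 1` visiting `c, …, n + 1`, which is the long
cycle built so far. -/
def OpenState (c n : ℕ) (M : Multiset ℕ) : Prop :=
  ∃ (S T U : Multiset ℕ) (A B C D : Multiset (Sym2 ℕ)),
    WalkOn 0 2 S A ∧ WalkOn (n + 1) (n + 2) T B ∧ S + T = Multiset.range (n + 3) ∧
    WalkOn n (n + 1) U C ∧ U + Multiset.range c = Multiset.range (n + 2) ∧
    CycleSum IsShort M D ∧ A + B + C + D = strip n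

/-- A decomposition of `strip n` that becomes one of the circulant graph when the two ends of the
strip are glued. It consists of cycles with lengths `M`; of two paths from `0` to `2` and from `n`
to `n + 2`, together visiting each of `0, …, n, n + 2` once; and of a cycle of length `k` whose
vertices stay distinct modulo `n` if `k ≤ n`. -/
def ClosedState (n k : ℕ) (M : Multiset ℕ) : Prop :=
  ∃ (S T U : Multiset ℕ) (A B C D : Multiset (Sym2 ℕ)),
    WalkOn 0 2 S A ∧ WalkOn n (n + 2) T B ∧ S + T = Multiset.range n + {n, n + 2} ∧
    ClosedWalkOn U C ∧ U.Nodup ∧ U.card = k ∧ (∃ c, ∀ x ∈ U, c ≤ x ∧ x < c + max n k) ∧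
    CycleSum IsShort M D ∧ A + B + C + D = strip n

theorem range_add_pair (n : ℕ) :
    Multiset.range (n + 2) = Multiset.range n + {n, n + 1} := by
  rw [Multiset.range_add]; rfl

theorem range_add_triple (n : ℕ) :
    Multiset.range (n + 3) = Multiset.range n + {n} + {n + 1, n + 2} := by
  rw [Multiset.range_add, add_assoc]; rfl

/-- A block of width `w` lengthening the long cycle by `w`: the strands `p`, `q` prolong the long
cycle, the strands `r`, `s` the Hamiltonian cycle. -/
theorem OpenState.step {c n : ℕ} {M : Multiset ℕ} (h : OpenState c n M) (w : ℕ)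
    (cs : List (List ℕ)) (p q r s : List ℕ) (hcs : AreShort cs)
    (hpq : AreStrands p q 0 1 w (w + 1)) (hrs : AreStrands r s 1 2 (w + 1) (w + 2))
    (hV : (p + q : Multiset ℕ) = Multiset.range (w + 2))
    (hW : {0} + (r + s : Multiset ℕ) = Multiset.range (w + 3))
    (hE : pathEdges r + pathEdges s + (pathEdges p + pathEdges q) + (cs.map cycleEdges).sum
      = strip w) :
    OpenState c (n + w) (M + (cs.map List.length : List ℕ)) := by
  obtain ⟨S, T, U, A, B, C, D, hA, hB, hST, hC, hU, hD, hE'⟩ := h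
  obtain ⟨T', hT', hB'⟩ := hB.strands hrs
  obtain ⟨U', hU', hC'⟩ := WalkOn.strands (p := 0) hC hpq
  refine ⟨S, T', U', A, _, _, _, hA, hB', ?_, hC', ?_,
    hD.add ((cycleSum_of_areShort hcs).map (n + ·) fun _ hS => hS.map_add n), ?_⟩
  · refine add_right_cancel (b := {n + 1, n + 2}) (add_right_cancel (b := {n}) ?_)
    calc S + T' + {n + 1, n + 2} + {n}
        = S + (T' + {n + 1, n + 2}) + {n} := by abel
      _ = S + T + ({0} + (r + s : Multiset ℕ)).map (n + ·) := by
          rw [hT', Multiset.map_add _ {0}, Multiset.map_singleton, add_zero]; abel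
      _ = Multiset.range n + (Multiset.range (w + 3)).map (n + ·) + {n + 1, n + 2} + {n} := by
          rw [hST, hW, range_add_triple n]; abel
      _ = _ := by rw [← Multiset.range_add, ← add_assoc]
  · refine add_right_cancel (b := {n, n + 1}) ?_
    calc U' + Multiset.range c + {n, n + 1}
        = U' + {n + 0, n + 1} + Multiset.range c := by rw [add_zero]; abel
      _ = U + Multiset.range c + (Multiset.range (w + 2)).map (n + ·) := by
          rw [hU', hV]; abel
      _ = Multiset.range n + (Multiset.range (w + 2)).map (n + ·) + {n, n + 1} := by
          rw [hU, range_add_pair n]; abel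
      _ = _ := by rw [← Multiset.range_add, ← add_assoc]
  · rw [strip_add, ← hE, ← hE']
    simp only [Multiset.map_add]
    abel

/-- A block of width `w` closing the long cycle by the path `t`; the strands `r`, `s` prolong the
Hamiltonian cycle. -/
theorem OpenState.close {c n : ℕ} {M : Multiset ℕ} (h : OpenState c n M) (w : ℕ)
    (cs : List (List ℕ)) (t r s : List ℕ) {k : ℕ} (hk : k + c = n + t.length) (hcs : AreShort cs)
    (ht : t.head? = some 0 ∧ t.getLast? = some 1 ∧ t.Nodup ∧ ∀ x ∈ t, x < max w t.length)
    (hrs : AreStrands r s 1 2 w (w + 2))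
    (hW : {0} + (r + s : Multiset ℕ) = Multiset.range w + {w, w + 2})
    (hE : pathEdges r + pathEdges s + pathEdges t + (cs.map cycleEdges).sum = strip w) :
    ClosedState (n + w) k (M + (cs.map List.length : List ℕ)) := by
  obtain ⟨S, T, U, A, B, C, D, hA, hB, hST, hC, hU, hD, hE'⟩ := h
  obtain ⟨ht₀, ht₁, htn, htw⟩ := ht
  obtain ⟨T', hT', hB'⟩ := hB.strands hrs
  obtain ⟨U', hU', hC'⟩ := ClosedWalkOn.of_walkOn (Nat.ne_of_lt n.lt_succ_self) hC
    ((walkOn_of_list ht₀ ht₁).map (n + ·))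
  have hU'' : U' + Multiset.range c = Multiset.range n + (t : Multiset ℕ).map (n + ·) := by
    refine add_right_cancel (b := {n, n + 1}) ?_
    calc U' + Multiset.range c + {n, n + 1}
        = U' + {n, n + 1} + Multiset.range c := by abel
      _ = U + Multiset.range c + (t : Multiset ℕ).map (n + ·) := by rw [hU']; abel
      _ = _ := by rw [hU, range_add_pair n]; abel
  have hn : (U' + Multiset.range c).Nodup := by
    rw [hU'', Multiset.nodup_add, Multiset.disjoint_left]
    refine ⟨Multiset.nodup_range n, Multiset.Nodup.map (add_right_injective n) htn, ?_⟩
    intro x hx hx'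
    obtain ⟨y, _, rfl⟩ := Multiset.mem_map.1 hx'
    have := Multiset.mem_range.1 hx
    lia
  obtain ⟨hn₁, -, hn₂⟩ := Multiset.nodup_add.1 hn
  refine ⟨S, T', U', A, _, _, _, hA, hB', ?_, hC', hn₁, ?_, ⟨c, fun x hx => ⟨?_, ?_⟩⟩,
    hD.add ((cycleSum_of_areShort hcs).map (n + ·) fun _ hS => hS.map_add n), ?_⟩
  · refine add_right_cancel (b := {n + 1, n + 2}) (add_right_cancel (b := {n}) ?_)
    calc S + T' + {n + 1, n + 2} + {n}
        = S + (T' + {n + 1, n + 2}) + {n} := by abel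
      _ = S + T + ({0} + (r + s : Multiset ℕ)).map (n + ·) := by
          rw [hT', Multiset.map_add _ {0}, Multiset.map_singleton, add_zero]; abel
      _ = Multiset.range n + (Multiset.range w + {w, w + 2}).map (n + ·)
            + {n + 1, n + 2} + {n} := by
          rw [hST, hW, range_add_triple n]; abel
      _ = _ := by rw [Multiset.map_add, ← add_assoc, ← Multiset.range_add]; rfl
  · have := congrArg Multiset.card hU''
    simp at this
    lia
  · by_contra! hc
    exact Multiset.disjoint_left.1 hn₂ hx (Multiset.mem_range.2 hc)
  · have : x ∈ Multiset.range n + (t : Multiset ℕ).map (n + ·) :=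
      hU'' ▸ Multiset.mem_add.2 (Or.inl hx)
    rcases Multiset.mem_add.1 this with hx | hx
    · have := Multiset.mem_range.1 hx
      lia
    · obtain ⟨y, hy, rfl⟩ := Multiset.mem_map.1 hx
      have := htw y hy
      lia
  · rw [strip_add, ← hE, ← hE']
    simp only [Multiset.map_add]
    abel

/-- A block of width `w` outside of the long cycle; the strands `r`, `s` prolong the Hamiltonian
cycle. -/
theorem ClosedState.step {n k : ℕ} {M : Multiset ℕ} (h : ClosedState n k M) (w : ℕ)
    (cs : List (List ℕ)) (r s : List ℕ) (hcs : AreShort cs) (hrs : AreStrands r s 0 2 w (w + 2))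
    (hW : (r + s : Multiset ℕ) = Multiset.range w + {w, w + 2})
    (hE : pathEdges r + pathEdges s + (cs.map cycleEdges).sum = strip w) :
    ClosedState (n + w) k (M + (cs.map List.length : List ℕ)) := by
  obtain ⟨S, T, U, A, B, C, D, hA, hB, hST, hC, hU, hk, ⟨c, hc⟩, hD, hE'⟩ := h
  obtain ⟨T', hT', hB'⟩ := WalkOn.strands (p := 0) hB hrs
  refine ⟨S, T', U, A, _, C, _, hA, hB', ?_, hC, hU, hk, ⟨c, fun x hx => ?_⟩,
    hD.add ((cycleSum_of_areShort hcs).map (n + ·) fun _ hS => hS.map_add n), ?_⟩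
  · refine add_right_cancel (b := {n, n + 2}) ?_
    calc S + T' + {n, n + 2}
        = S + (T' + {n + 0, n + 2}) := by rw [add_zero]; abel
      _ = S + T + (Multiset.range w + {w, w + 2}).map (n + ·) := by
          rw [hT', hW]; abel
      _ = Multiset.range n + (Multiset.range w + {w, w + 2}).map (n + ·) + {n, n + 2} := by
          rw [hST]; abel
      _ = _ := by rw [Multiset.map_add, ← add_assoc, ← Multiset.range_add]; rfl
  · have := hc x hx
    lia
  · rw [strip_add, ← hE, ← hE']
    simp only [Multiset.map_add]
    abel

/-! ### The blocks -/

/-- The multiset of `a` threes, `b` fours and `e` fives. -/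
def lengths (a b e : ℕ) : Multiset ℕ :=
  Multiset.replicate a 3 + Multiset.replicate b 4 + Multiset.replicate e 5

theorem lengths_add (a b e a' b' e' : ℕ) :
    lengths (a + a') (b + b') (e + e') = lengths a b e + lengths a' b' e' := by
  simp only [lengths, Multiset.replicate_add]
  abel

theorem lengths_add_three (a b e : ℕ) : lengths (1 + a) b e = {3} + lengths a b e := by
  have h := lengths_add 1 0 0 a b e
  rw [zero_add, zero_add] at h
  exact h

theorem lengths_add_three_three (a b e : ℕ) :
    lengths (2 + a) b e = {3, 3} + lengths a b e := by
  have h := lengths_add 2 0 0 a b e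
  rw [zero_add, zero_add] at h
  exact h

theorem lengths_add_four (a b e : ℕ) : lengths a (1 + b) e = {4} + lengths a b e := by
  have h := lengths_add 0 1 0 a b e
  rw [zero_add, zero_add] at h
  exact h

theorem lengths_add_five (a b e : ℕ) : lengths a b (1 + e) = {5} + lengths a b e := by
  have h := lengths_add 0 0 1 a b e
  rw [zero_add, zero_add] at h
  exact h

/-- The path `2, 1, 0, 3` of the long cycle, and the paths `0, 2` and `3, 1, 4` of the Hamiltonian
cycle. -/
theorem OpenState.base : OpenState 0 2 0 := by
  refine ⟨([0, 2] : List ℕ), ([3, 1, 4] : List ℕ), ([2, 1, 0, 3] : List ℕ), _, _, _, 0,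
    walkOn_of_list rfl rfl, walkOn_of_list rfl rfl, ?_, walkOn_of_list rfl rfl, ?_, .nil, ?_⟩ <;>
  decide

/-- A triangle, the path `4, 3, 1, 2, 5` of the long cycle, and the paths `0, 1, 4, 2` and `5, 3, 6`
of the Hamiltonian cycle. -/
theorem OpenState.base_three : OpenState 1 4 {3} := by
  refine ⟨([0, 1, 4, 2] : List ℕ), ([5, 3, 6] : List ℕ), ([4, 3, 1, 2, 5] : List ℕ), _, _, _, _,
    walkOn_of_list rfl rfl, walkOn_of_list rfl rfl, ?_, walkOn_of_list rfl rfl, ?_,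
    cycleSum_of_areShort (cs := [[0, 2, 3]]) ?_, ?_⟩ <;>
  decide

/-- Four triangles, one of which counts as the long cycle, and the paths `0, 3, 1, 4, 2` and
`6, 5, 8` of the Hamiltonian cycle. -/
theorem ClosedState.base_three : ClosedState 6 3 {3, 3, 3} := by
  refine ⟨([0, 3, 1, 4, 2] : List ℕ), ([6, 5, 8] : List ℕ), ([0, 1, 2] : List ℕ), _, _, _, _,
    walkOn_of_list rfl rfl, walkOn_of_list rfl rfl, ?_, closedWalkOn_cycleEdges ?_, ?_, rfl, ⟨0, ?_⟩,
    cycleSum_of_areShort (cs := [[2, 3, 5], [3, 4, 6], [4, 5, 7]]) ?_, ?_⟩ <;>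
  decide

theorem OpenState.step_four {c n : ℕ} {M : Multiset ℕ} (h : OpenState c n M) :
    OpenState c (n + 4) (M + {4}) :=
  h.step 4 [[0, 1, 2, 3]] [0, 2, 4] [1, 3, 5] [1, 4, 3, 6] [2, 5]
    (by decide) (by decide) (by decide) (by decide) (by decide) (by decide)

theorem OpenState.step_five {c n : ℕ} {M : Multiset ℕ} (h : OpenState c n M) :
    OpenState c (n + 5) (M + {5}) :=
  h.step 5 [[0, 1, 2, 4, 3]] [0, 2, 3, 5] [1, 4, 6] [1, 3, 6] [2, 5, 4, 7]
    (by decide) (by decide) (by decide) (by decide) (by decide) (by decide)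

theorem OpenState.step_three_three {c n : ℕ} {M : Multiset ℕ} (h : OpenState c n M) :
    OpenState c (n + 6) (M + {3, 3}) :=
  h.step 6 [[0, 1, 2], [3, 4, 5]] [0, 3, 2, 5, 7] [1, 4, 6] [1, 3, 6, 5, 8] [2, 4, 7]
    (by decide) (by decide) (by decide) (by decide) (by decide) (by decide)

/-! ### Choosing the blocks -/

/-- Cycles of lengths `3`, `4`, `5` can be added outside of the long cycle whenever the sum of their
lengths is even: every such multiset of lengths is a union of copies of `{4}`, `{3, 3}`, `{3, 5}`
and `{5, 5}`. -/
theorem ClosedState.fill {n k : ℕ} {M : Multiset ℕ} (h : ClosedState n k M) {N a b e : ℕ}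
    (hN : 2 * N = 2 * n + 3 * a + 4 * b + 5 * e) : ClosedState N k (M + lengths a b e) := by
  induction hm : a + b + e using Nat.strong_induction_on generalizing n M a b e with
  | _ m ih =>
    subst hm
    -- Adds a block whose cycle lengths are `a₀` threes, `b₀` fours and `e₀` fives.
    have key : ∀ (w a₀ b₀ e₀ : ℕ) {L : Multiset ℕ}, ClosedState (n + w) k (M + L) →
        L = lengths a₀ b₀ e₀ → a₀ ≤ a → b₀ ≤ b → e₀ ≤ e → 0 < a₀ + b₀ + e₀ →
        2 * w = 3 * a₀ + 4 * b₀ + 5 * e₀ → ClosedState N k (M + lengths a b e) := by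
      rintro w a₀ b₀ e₀ L h' rfl ha hb he h0 hw
      obtain ⟨a, rfl⟩ := Nat.exists_eq_add_of_le ha
      obtain ⟨b, rfl⟩ := Nat.exists_eq_add_of_le hb
      obtain ⟨e, rfl⟩ := Nat.exists_eq_add_of_le he
      rw [lengths_add, ← add_assoc]
      exact ih (a + b + e) (by lia) h' (by lia) rfl
    by_cases hb : 1 ≤ b
    · exact key 2 0 1 0 (h.step 2 [[0, 2, 1, 3]] [0, 1, 4] [2]
        (by decide) (by decide) (by decide) (by decide))
        (by decide) (by lia) hb (by lia) (by lia) (by lia)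
    by_cases ha : 2 ≤ a
    · exact key 3 2 0 0 (h.step 3 [[0, 2, 3], [1, 2, 4]] [0, 1, 3] [2, 5]
        (by decide) (by decide) (by decide) (by decide))
        (by decide) ha (by lia) (by lia) (by lia) (by lia)
    by_cases he : 2 ≤ e
    · exact key 5 0 0 2 (h.step 5 [[0, 1, 3, 4, 2], [2, 3, 6, 4, 5]] [0, 3, 5] [2, 1, 4, 7]
        (by decide) (by decide) (by decide) (by decide))
        (by decide) (by lia) (by lia) he (by lia) (by lia)
    by_cases hae : 1 ≤ a
    · exact key 4 1 0 1 (h.step 4 [[0, 1, 3, 4, 2], [2, 3, 5]] [0, 3, 6] [2, 1, 4]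
        (by decide) (by decide) (by decide) (by decide))
        (by decide) hae (by lia) (by lia) (by lia) (by lia)
    obtain ⟨rfl, rfl, rfl, rfl⟩ : a = 0 ∧ b = 0 ∧ e = 0 ∧ N = n := by lia
    simpa [lengths] using h

/-- Part `L` of the prescribed lengths has been used by the block that closes the long cycle. -/
theorem ClosedState.fill_of_le {n k : ℕ} {L M : Multiset ℕ} (h : ClosedState n k (M + L))
    (a₀ b₀ e₀ : ℕ) (hL : L = lengths a₀ b₀ e₀) {N a b e : ℕ} (ha : a₀ ≤ a) (hb : b₀ ≤ b)
    (he : e₀ ≤ e)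
    (hN : 2 * N + 3 * a₀ + 4 * b₀ + 5 * e₀ = 2 * n + 3 * a + 4 * b + 5 * e) :
    ClosedState N k (M + lengths a b e) := by
  subst hL
  obtain ⟨a, rfl⟩ := Nat.exists_eq_add_of_le ha
  obtain ⟨b, rfl⟩ := Nat.exists_eq_add_of_le hb
  obtain ⟨e, rfl⟩ := Nat.exists_eq_add_of_le he
  rw [lengths_add, ← add_assoc]
  exact h.fill (by lia)

/-- When the long cycle misses the vertex `0`, it is lengthened by pairs of threes until the path
closing it has `3` or `6` vertices. -/
theorem OpenState.finish_threes {n : ℕ} {M : Multiset ℕ} (h : OpenState 1 n M) {N k a : ℕ}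
    (hk : n + 2 ≤ k) (hkN : k ≤ N) (hN : 2 * N + 2 = k + n + 1 + 3 * a) (h3 : 3 ∣ k + 1 - n) :
    ClosedState N k (M + lengths a 0 0) := by
  induction a using Nat.strong_induction_on generalizing n M with
  | _ a ih =>
    by_cases h8 : n + 8 ≤ k
    · obtain ⟨a, rfl⟩ : ∃ b, a = 2 + b := ⟨a - 2, by lia⟩
      rw [lengths_add_three_three, ← add_assoc]
      exact ih a (by lia) h.step_three_three (by lia) (by lia) (by lia)
    obtain rfl | rfl : k = n + 2 ∨ k = n + 5 := by lia
    · exact (h.close 2 [[0, 1, 3]] [0, 2, 1] [1, 4] [2] (by simp)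
        (by decide) (by decide) (by decide) (by decide) (by decide)).fill_of_le 1 0 0
        (by decide) (by lia) (by lia) (by lia) (by lia)
    · exact (h.close 5 [[0, 1, 2], [3, 4, 6]] [0, 3, 2, 5, 4, 1] [1, 3, 5] [2, 4, 7] (by simp)
        (by decide) (by decide) (by decide) (by decide) (by decide)).fill_of_le 2 0 0
        (by decide) (by lia) (by lia) (by lia) (by lia)

/-- The blocks that lengthen the long cycle are used until `k ≤ n + 6`, so that the closing path has
between `2` and `6` vertices. A pair of threes goes first: this keeps a four or a five at hand, which
is needed when the closing path has four vertices, and which lengthens the long cycle once more when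
that path would have seven. -/
theorem OpenState.finish {n : ℕ} {M : Multiset ℕ} (h : OpenState 0 n M) {N k a b e : ℕ}
    (hk : n + 2 ≤ k) (hkN : k ≤ N) (hN : 2 * N + 2 = k + n + 3 * a + 4 * b + 5 * e)
    (h3 : 0 < b + e ∨ ¬ 3 ∣ k + 2 - n) : ClosedState N k (M + lengths a b e) := by
  induction hm : a + b + e using Nat.strong_induction_on generalizing n M a b e with
  | _ m ih =>
    subst hm
    by_cases h33 : 2 ≤ a ∧ n + 8 ≤ k
    · obtain ⟨a, rfl⟩ : ∃ a', a = 2 + a' := ⟨a - 2, by lia⟩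
      rw [lengths_add_three_three, ← add_assoc]
      exact ih _ (by lia) h.step_three_three (by lia) (by lia) (by lia) rfl
    by_cases h4 : 1 ≤ b ∧ n + 6 ≤ k
    · obtain ⟨b, rfl⟩ : ∃ b', b = 1 + b' := ⟨b - 1, by lia⟩
      rw [lengths_add_four, ← add_assoc]
      exact ih _ (by lia) h.step_four (by lia) (by lia) (by lia) rfl
    by_cases h5 : 1 ≤ e ∧ n + 7 ≤ k
    · obtain ⟨e, rfl⟩ : ∃ e', e = 1 + e' := ⟨e - 1, by lia⟩
      rw [lengths_add_five, ← add_assoc]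
      exact ih _ (by lia) h.step_five (by lia) (by lia) (by lia) rfl
    have h6 : k ≤ n + 6 := by lia
    obtain rfl | rfl | rfl | rfl | rfl :
        k = n + 2 ∨ k = n + 3 ∨ k = n + 4 ∨ k = n + 5 ∨ k = n + 6 := by lia
    · by_cases hb : 1 ≤ b
      · exact (h.close 2 [[0, 2, 1, 3]] [0, 1] [1, 4] [2] (by simp)
          (by decide) (by decide) (by decide) (by decide) (by decide)).fill_of_le 0 1 0
          (by decide) (by lia) (by lia) (by lia) (by lia)
      by_cases ha : 2 ≤ a
      · exact (h.close 3 [[0, 2, 3], [1, 2, 4]] [0, 1] [1, 3] [2, 5] (by simp)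
          (by decide) (by decide) (by decide) (by decide) (by decide)).fill_of_le 2 0 0
          (by decide) (by lia) (by lia) (by lia) (by lia)
      by_cases he : 2 ≤ e
      · exact (h.close 5 [[0, 2, 1, 4, 3], [2, 3, 6, 4, 5]] [0, 1] [1, 3, 5] [2, 4, 7] (by simp)
          (by decide) (by decide) (by decide) (by decide) (by decide)).fill_of_le 0 0 2
          (by decide) (by lia) (by lia) (by lia) (by lia)
      · exact (h.close 4 [[0, 2, 1, 4, 3], [2, 3, 5]] [0, 1] [1, 3, 6] [2, 4] (by simp)
          (by decide) (by decide) (by decide) (by decide) (by decide)).fill_of_le 1 0 1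
          (by decide) (by lia) (by lia) (by lia) (by lia)
    · by_cases ha : 1 ≤ a
      · exact (h.close 2 [[0, 1, 3]] [0, 2, 1] [1, 4] [2] (by simp)
          (by decide) (by decide) (by decide) (by decide) (by decide)).fill_of_le 1 0 0
          (by decide) (by lia) (by lia) (by lia) (by lia)
      · exact (h.close 3 [[0, 1, 4, 2, 3]] [0, 2, 1] [1, 3] [2, 5] (by simp)
          (by decide) (by decide) (by decide) (by decide) (by decide)).fill_of_le 0 0 1
          (by decide) (by lia) (by lia) (by lia) (by lia)
    · by_cases hb : 1 ≤ b
      · exact (h.close 3 [[0, 1, 4, 2]] [0, 3, 2, 1] [1, 3] [2, 5] (by simp)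
          (by decide) (by decide) (by decide) (by decide) (by decide)).fill_of_le 0 1 0
          (by decide) (by lia) (by lia) (by lia) (by lia)
      by_cases ha : 1 ≤ a
      · exact (h.close 5 [[0, 1, 4, 5, 2], [3, 4, 6]] [0, 3, 2, 1] [1, 3, 5] [2, 4, 7] (by simp)
          (by decide) (by decide) (by decide) (by decide) (by decide)).fill_of_le 1 0 1
          (by decide) (by lia) (by lia) (by lia) (by lia)
      · exact (h.close 6 [[0, 1, 4, 5, 2], [3, 4, 7, 5, 6]] [0, 3, 2, 1] [1, 3, 5, 8] [2, 4, 6]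
          (by simp) (by decide) (by decide) (by decide) (by decide) (by decide)).fill_of_le 0 0 2
          (by decide) (by lia) (by lia) (by lia) (by lia)
    · by_cases ha : 1 ≤ a
      · exact (h.close 3 [[0, 1, 2]] [0, 3, 2, 4, 1] [1, 3] [2, 5] (by simp)
          (by decide) (by decide) (by decide) (by decide) (by decide)).fill_of_le 1 0 0
          (by decide) (by lia) (by lia) (by lia) (by lia)
      · exact (h.close 4 [[0, 1, 2, 5, 3]] [0, 2, 3, 4, 1] [1, 3, 6] [2, 4] (by simp)
          (by decide) (by decide) (by decide) (by decide) (by decide)).fill_of_le 0 0 1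
          (by decide) (by lia) (by lia) (by lia) (by lia)
    · by_cases ha : 2 ≤ a
      · exact (h.close 5 [[0, 1, 2], [3, 4, 6]] [0, 3, 2, 5, 4, 1] [1, 3, 5] [2, 4, 7] (by simp)
          (by decide) (by decide) (by decide) (by decide) (by decide)).fill_of_le 2 0 0
          (by decide) (by lia) (by lia) (by lia) (by lia)
      by_cases he : 2 ≤ e
      · exact (h.close 7 [[0, 1, 2, 4, 3], [4, 5, 8, 6, 7]] [0, 2, 5, 6, 3, 1] [1, 4, 6, 9]
          [2, 3, 5, 7] (by simp)
          (by decide) (by decide) (by decide) (by decide) (by decide)).fill_of_le 0 0 2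
          (by decide) (by lia) (by lia) (by lia) (by lia)
      · exact (h.close 6 [[3, 4, 7, 5, 6], [0, 1, 2]] [0, 3, 2, 5, 4, 1] [1, 3, 5, 8] [2, 4, 6]
          (by simp) (by decide) (by decide) (by decide) (by decide) (by decide)).fill_of_le 1 0 1
          (by decide) (by lia) (by lia) (by lia) (by lia)

/-! ### Closing the strip -/

/-- Reduction modulo `n` is injective on `n` consecutive numbers. -/
theorem natCast_zmod_inj_of_window {n c x y : ℕ} (hx : c ≤ x ∧ x < c + n) (hy : c ≤ y ∧ y < c + n)
    (h : (x : ZMod n) = y) : x = y := by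
  refine Nat.ModEq.eq_of_abs_lt ((ZMod.natCast_eq_natCast_iff x y n).1 h) ?_
  rw [abs_lt]
  constructor <;> lia

theorem nodup_map_natCast_of_window {n c : ℕ} {S : Multiset ℕ} (h : S.Nodup)
    (hS : ∀ x ∈ S, c ≤ x ∧ x < c + n) : (S.map (Nat.cast : ℕ → ZMod n)).Nodup :=
  h.map_on fun x hx y hy => natCast_zmod_inj_of_window (hS x hx) (hS y hy)

theorem strip_eq_map (w : ℕ) :
    strip w = (Multiset.range w ×ˢ ({1, 2, 3} : Multiset ℕ)).map fun p => s(p.1, p.1 + p.2) := by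
  simp only [strip, SProd.sprod, Multiset.product, Multiset.map_bind]
  rfl

theorem nodup_map_strip {n : ℕ} (hn : 7 ≤ n) :
    ((strip n).map (Sym2.map (Nat.cast : ℕ → ZMod n))).Nodup := by
  rw [strip_eq_map, Multiset.map_map]
  refine Multiset.Nodup.map_on ?_ ((Multiset.nodup_range n).product (by decide))
  rintro ⟨i, d⟩ hi ⟨j, f⟩ hj h
  simp only [Multiset.mem_product, Multiset.mem_range, Multiset.insert_eq_cons,
    Multiset.mem_cons, Multiset.mem_singleton] at hi hj
  simp only [Function.comp_apply, Sym2.map_mk, Nat.cast_add, Sym2.eq_iff] at h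
  rcases h with ⟨h₁, h₂⟩ | ⟨h₁, h₂⟩
  · obtain rfl : i = j := natCast_zmod_inj_of_window (c := 0) (by lia) (by lia) h₁
    rw [natCast_zmod_inj_of_window (n := n) (c := 0) (x := d) (y := f) (by lia) (by lia)
      (add_left_cancel h₂)]
  · -- The two edges would be traversed in opposite directions, so `d + f` would vanish.
    have : ((d + f : ℕ) : ZMod n) = (0 : ℕ) := by
      rw [h₁] at h₂
      push_cast
      linear_combination h₂
    have := natCast_zmod_inj_of_window (c := 0) (by lia) (by lia) this
    lia

theorem mem_map_strip_iff {n : ℕ} (hn : 7 ≤ n) (e : Sym2 (ZMod n)) :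
    e ∈ (strip n).map (Sym2.map (Nat.cast : ℕ → ZMod n)) ↔
      e ∈ (SimpleGraph.circulantGraph ({1, 2, 3} : Set (ZMod n))).edgeSet := by
  have : NeZero n := ⟨by lia⟩
  have key : ∀ x y : ZMod n, y - x ∈ ({1, 2, 3} : Set (ZMod n)) →
      s(x, y) ∈ (strip n).map (Sym2.map (Nat.cast : ℕ → ZMod n)) := by
    intro x y h
    obtain ⟨d, hd, hxy⟩ : ∃ d ∈ ({1, 2, 3} : Multiset ℕ), y - x = (d : ZMod n) := by
      rcases h with h | h | h
      · exact ⟨1, by simp, by simpa using h⟩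
      · exact ⟨2, by simp, by simpa using h⟩
      · exact ⟨3, by simp, by simpa using h⟩
    rw [strip_eq_map, Multiset.map_map]
    refine Multiset.mem_map.2 ⟨(x.val, d), Multiset.mem_product.2
      ⟨Multiset.mem_range.2 x.val_lt, hd⟩, ?_⟩
    simp [← hxy]
  induction e using Sym2.ind with
  | _ x y =>
    rw [SimpleGraph.mem_edgeSet, SimpleGraph.circulantGraph_adj]
    constructor
    · intro h
      rw [strip_eq_map, Multiset.map_map] at h
      obtain ⟨⟨i, d⟩, hi, h⟩ := Multiset.mem_map.1 h
      have hd : d = 1 ∨ d = 2 ∨ d = 3 := by simpa using (Multiset.mem_product.1 hi).2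
      have hd' : (d : ZMod n) ∈ ({1, 2, 3} : Set (ZMod n)) := by
        rcases hd with rfl | rfl | rfl <;> simp
      have hd0 : (d : ZMod n) ≠ 0 := by
        intro h0
        have := natCast_zmod_inj_of_window (n := n) (c := 0) (x := d) (y := 0) (by lia) (by lia)
          (by simpa using h0)
        lia
      simp only [Function.comp_apply, Sym2.map_mk, Nat.cast_add, Sym2.eq_iff] at h
      rcases h with ⟨rfl, rfl⟩ | ⟨rfl, rfl⟩
      · exact ⟨by simpa using hd0, Or.inr (by simpa using hd')⟩
      · exact ⟨by simpa using hd0, Or.inl (by simpa using hd')⟩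
    · rintro ⟨-, h | h⟩
      · rw [Sym2.eq_swap]
        exact key y x h
      · exact key x y h

/-- Gluing the ends of the strip turns the two paths of the Hamiltonian cycle into one cycle through
`0, …, n - 1`, while the other cycles keep their vertices distinct. -/
theorem ClosedState.hasCycleDecomposition {n k : ℕ} {M : Multiset ℕ} (h : ClosedState n k M)
    (hn : 7 ≤ n) (hk : k ≤ n) {l : List ℕ} (hl : M + {k, n} = (l : Multiset ℕ)) :
    HasCycleDecomposition (SimpleGraph.circulantGraph ({1, 2, 3} : Set (ZMod n))) l := by
  obtain ⟨S, T, U, A, B, C, D, hA, hB, hST, hC, hU, rfl, ⟨c, hc⟩, hD, hE⟩ := h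
  rw [max_eq_left hk] at hc
  -- Modulo `n`, the two paths of the Hamiltonian cycle have the same ends.
  have h02 : ((0 : ℕ) : ZMod n) ≠ (2 : ℕ) := fun h => by
    have := natCast_zmod_inj_of_window (c := 0) (by lia) (by lia) h
    lia
  have hB' := hB.map (Nat.cast : ℕ → ZMod n)
  rw [show ((n : ℕ) : ZMod n) = (0 : ℕ) by simp,
    show ((n + 2 : ℕ) : ZMod n) = (2 : ℕ) by simp] at hB'
  obtain ⟨H, hH, hHc⟩ := ClosedWalkOn.of_walkOn h02 (hA.map (Nat.cast : ℕ → ZMod n)) hB'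
  obtain rfl : H = (Multiset.range n).map (Nat.cast : ℕ → ZMod n) := by
    rw [← Multiset.map_add, hST, Multiset.map_add] at hH
    simpa using hH
  have hD' := hD.map (Q := Multiset.Nodup) (Nat.cast : ℕ → ZMod n) fun S hS => by
    obtain ⟨hS, c, hc⟩ := hS
    exact nodup_map_natCast_of_window (c := c) hS fun x hx => by
      have := hc x hx
      lia
  have hsum := (CycleSum.cons hHc (nodup_map_natCast_of_window (c := 0) (Multiset.nodup_range n)
      fun x hx => by simpa using hx)
    (.cons (hC.map (Nat.cast : ℕ → ZMod n)) (nodup_map_natCast_of_window hU hc) hD'))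
  rw [Multiset.card_map, Multiset.card_map, Multiset.card_range, ← Multiset.singleton_add,
    ← Multiset.singleton_add,
    show {n} + ({U.card} + M) = M + {U.card, n} by
      rw [Multiset.insert_eq_cons, ← Multiset.singleton_add]; abel, hl] at hsum
  have hEE : A.map (Sym2.map (Nat.cast : ℕ → ZMod n)) + B.map (Sym2.map Nat.cast) +
      (C.map (Sym2.map Nat.cast) + D.map (Sym2.map Nat.cast)) =
      (strip n).map (Sym2.map Nat.cast) := by
    rw [← hE]
    simp only [Multiset.map_add]
    abel
  rw [hEE] at hsum
  exact hasCycleDecomposition_of_cycleSum hsum (nodup_map_strip hn) (mem_map_strip_iff hn)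

/-! ### All lists of lengths -/

theorem exists_eq_lengths {m : List ℕ} (hm : ∀ x ∈ m, x = 3 ∨ x = 4 ∨ x = 5) :
    ∃ a b e, (m : Multiset ℕ) = lengths a b e ∧ m.sum = 3 * a + 4 * b + 5 * e := by
  induction m with
  | nil => exact ⟨0, 0, 0, rfl, rfl⟩
  | cons x m ih =>
    obtain ⟨a, b, e, h, hs⟩ := ih fun y hy => hm y (by simp [hy])
    rcases hm x (by simp) with rfl | rfl | rfl
    · refine ⟨1 + a, b, e, ?_, by simp [hs]; lia⟩
      rw [← Multiset.cons_coe, h, lengths_add_three]; rfl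
    · refine ⟨a, 1 + b, e, ?_, by simp [hs]; lia⟩
      rw [← Multiset.cons_coe, h, lengths_add_four]; rfl
    · refine ⟨a, b, 1 + e, ?_, by simp [hs]; lia⟩
      rw [← Multiset.cons_coe, h, lengths_add_five]; rfl

theorem mainTheorem5 (n : ℕ) (hn : 7 ≤ n) (m : List ℕ) (hm : ∀ x ∈ m, x = 3 ∨ x = 4 ∨ x = 5)
    (k : ℕ) (hk3 : 3 ≤ k) (hkn : k ≤ n) (hsum : (m ++ [k, n]).sum = 3 * n) :
    HasCycleDecomposition (SimpleGraph.circulantGraph ({1, 2, 3} : Set (ZMod n)))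
      (m ++ [k, n]) := by
  obtain ⟨a, b, e, hM, hs⟩ := exists_eq_lengths hm
  have hl : lengths a b e + {k, n} = ((m ++ [k, n] : List ℕ) : Multiset ℕ) := by
    rw [← hM]; rfl
  have hs' : 2 * n = k + 3 * a + 4 * b + 5 * e := by
    simp at hsum
    lia
  by_cases h4 : 4 ≤ k
  · by_cases h3 : 0 < b + e ∨ ¬ 3 ∣ k
    · have := OpenState.base.finish (N := n) (k := k) (a := a) (b := b) (e := e) h4 hkn (by lia) h3
      exact this.hasCycleDecomposition hn hkn (by rw [zero_add, hl])
    · obtain ⟨a, rfl⟩ : ∃ a', a = 1 + a' := ⟨a - 1, by lia⟩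
      obtain ⟨rfl, rfl⟩ : b = 0 ∧ e = 0 := by lia
      have := OpenState.base_three.finish_threes (N := n) (k := k) (a := a) (by lia) hkn (by lia)
        (by lia)
      exact this.hasCycleDecomposition hn hkn (hl ▸ congrArg (· + _)
        (lengths_add 1 0 0 a 0 0).symm)
  obtain rfl : k = 3 := by lia
  -- If possible, a cycle of length `4` or `5` takes the role of the long cycle.
  by_cases hb : 1 ≤ b
  · obtain ⟨b, rfl⟩ : ∃ b', b = 1 + b' := ⟨b - 1, by lia⟩
    have := OpenState.base.finish (N := n) (k := 4) (a := 1 + a) (b := b) (e := e) (by lia)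
      (by lia) (by lia) (by lia)
    refine this.hasCycleDecomposition hn (by lia) ?_
    rw [← hl, zero_add, lengths_add_four, lengths_add_three]
    simp only [Multiset.insert_eq_cons, ← Multiset.singleton_add]
    abel
  by_cases he : 1 ≤ e
  · obtain ⟨e, rfl⟩ : ∃ e', e = 1 + e' := ⟨e - 1, by lia⟩
    have := OpenState.base.finish (N := n) (k := 5) (a := 1 + a) (b := b) (e := e) (by lia)
      (by lia) (by lia) (by lia)
    refine this.hasCycleDecomposition hn (by lia) ?_
    rw [← hl, zero_add, lengths_add_five, lengths_add_three]
    simp only [Multiset.insert_eq_cons, ← Multiset.singleton_add]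
    abel
  obtain ⟨rfl, rfl⟩ : b = 0 ∧ e = 0 := by lia
  obtain ⟨a, rfl⟩ : ∃ a', a = 3 + a' := ⟨a - 3, by lia⟩
  have := ClosedState.base_three.fill (N := n) (a := a) (b := 0) (e := 0) (by lia)
  exact this.hasCycleDecomposition hn hkn (hl ▸ congrArg (· + _) (lengths_add 3 0 0 a 0 0).symm)
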